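/- **Theorem 5.3.** Let $n,m\in\mathbb N$, $A\in\mathbb R^{n\times n}$, $B\in\mathbb R^{n\times m}$. A *$C$-set* is a compact convex set containing the origin; a *proper $C$-set* is a $C$-set containing the origin in its interior. For a set $X\ni 0$ in a Euclidean space, $X^*=\{x:\ y^Tx\le 1\ \ \forall y\in X\}$ is its polar set; $\oplus$ is Minkowski addition; $P_x:\mathbb R^{n+m}\to\mathbb R^n$ is the projection $(x,u)\mapsto x$; and $g_X(y)=\min\{\eta\ge 0:\ y\in\eta X\}$ is the Minkowski function of a proper $C$-set $X$. Assume that $(A,B)$ is strictly stabilizable, i.e. the uncontrollable part of $x^+=Ax+Bu$ (the map induced by $A$ on the quotient of $\mathbb R^n$ by the controllable subspace $\sum_{k\ge 0}\operatorname{range}(A^kB)$) has all its eigenvalues in the open unit disc, and that $\mathcal C$ is a proper $C$-set in $\mathbb R^{n+m}$. Consider the map $$F(\mathcal P)=P_x\left(\mathcal C^*\oplus (A\ B)^T\mathcal P^*\right)^*$$ on the state space $\mathbb S=\{\mathcal P\subseteq\mathbb R^n:\ 0\in\mathcal P,\ \mathcal P^*\text{ is a }C\text{-set}\}$, and the set dynamics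 $\mathcal P_{k+1}=F(\mathcal P_k)$, $\mathcal P_0\in\mathbb S$. 1. There is a unique proper $C$-set $\mathcal P_\infty$ in $\mathbb R^n$ with $\mathcal P_\infty=F(\mathcal P_\infty)$. 2. $F$ maps every element of $\mathbb S$ to a proper $C$-set, $\mathcal P_\infty\in\mathbb S$, and $\mathcal P_\infty$ is an asymptotically stable attractor of the set dynamics on $\mathbb S$ with respect to the Hausdorff distance $H$: for every $\varepsilon>0$ there is $\delta>0$ such that $\mathcal P_0\in\mathbb S$ and $H(\mathcal P_0,\mathcal P_\infty)<\delta$ imply $H(\mathcal P_k,\mathcal P_\infty)<\varepsilon$ for all $k$; and $H(\mathcal P_k,\mathcal P_\infty)\to0$ for all $\mathcal P_0\in\mathbb S$ in some $H$-neighbourhood of $\mathcal P_\infty$. 3. The domain of attraction $\{\mathcal P_0\in\mathbb S:\ H(\mathcal P_k,\mathcal P_\infty)\to 0\}$ is all of $\mathbb S$; the set of the polars $\mathcal P_0^*$ of its elements is the set of all $C$-sets in $\mathbb R^n$. 4. Consequently $V=g_{\mathcal P_\infty}$ solves the fixed point Minkowski–Bellman equation $$V(x)=\min_{u\in\mathbb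 R^m}\ g_{\mathcal C}(x,u)+V(Ax+Bu)\quad\text{for all }x\in\mathbb R^n,\qquad U(x)=\operatorname*{arg\,min}_{u\in\mathbb R^m}\ g_{\mathcal C}(x,u)+V(Ax+Bu),$$ (the minimum being attained), and it is the only $V$ solving it among the Minkowski functions of proper $C$-sets in $\mathbb R^n$. -/

import Mathlib

open Filter Topology
open scoped Pointwise ENNReal

noncomputable section

/-- A `C`-set: compact, convex, containing the origin. -/
def IsCSet {ι : Type*} [Fintype ι] (X : Set (EuclideanSpace ℝ ι)) : Prop :=
  IsCompact X ∧ Convex ℝ X ∧ (0 : EuclideanSpace ℝ ι) ∈ X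

/-- A proper `C`-set: a `C`-set containing the origin in its interior. -/
def IsProperCSet {ι : Type*} [Fintype ι] (X : Set (EuclideanSpace ℝ ι)) : Prop :=
  IsCSet X ∧ (0 : EuclideanSpace ℝ ι) ∈ interior X

/-- The (one-sided) polar set `X* = {x : ∀ y ∈ X, yᵀ x ≤ 1}`. -/
def polarSet {ι : Type*} [Fintype ι] (X : Set (EuclideanSpace ℝ ι)) :
    Set (EuclideanSpace ℝ ι) :=
  {x | ∀ y ∈ X, inner ℝ y x ≤ 1}

/-- The image `M X = {M x : x ∈ X}` of a set under a matrix. -/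
def matImage {ι κ : Type*} [Fintype ι] [DecidableEq ι] [Fintype κ] (M : Matrix κ ι ℝ)
    (X : Set (EuclideanSpace ℝ ι)) : Set (EuclideanSpace ℝ κ) :=
  (fun x => Matrix.toEuclideanLin M x) '' X

/-- The controllable subspace of `x⁺ = A x + B u`: the sum of the ranges of `Aᵏ B`, `k ∈ ℕ`. -/
def controllableSubspace {n m : ℕ} (A : Matrix (Fin n) (Fin n) ℝ) (B : Matrix (Fin n) (Fin m) ℝ) :
    Submodule ℝ (EuclideanSpace ℝ (Fin n)) :=
  ⨆ k : ℕ, LinearMap.range (Matrix.toEuclideanLin (A ^ k * B))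

theorem controllableSubspace_invariant {n m : ℕ} (A : Matrix (Fin n) (Fin n) ℝ)
    (B : Matrix (Fin n) (Fin m) ℝ) :
    controllableSubspace A B ≤
      (controllableSubspace A B).comap (Matrix.toEuclideanLin A) := by
  refine iSup_le fun k => ?_
  rintro _ ⟨u, rfl⟩
  refine Submodule.mem_iSup_of_mem (k + 1) ⟨u, ?_⟩
  simp [Matrix.toLpLin_apply, pow_succ', Matrix.mul_assoc]

/-- The uncontrollable part of the dynamics: the map induced by `A` on the quotient of the state
space by the controllable subspace. -/
def uncontrollablePart {n m : ℕ} (A : Matrix (Fin n) (Fin n) ℝ) (B : Matrix (Fin n) (Fin m) ℝ) :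
    Module.End ℝ (EuclideanSpace ℝ (Fin n) ⧸ controllableSubspace A B) :=
  (controllableSubspace A B).mapQ (controllableSubspace A B) (Matrix.toEuclideanLin A)
    (controllableSubspace_invariant A B)

/-- `(A, B)` is strictly stabilizable: the uncontrollable part is strictly stable, that is, all its
(complex) eigenvalues lie in the open unit disc. -/
def IsStrictlyStabilizable {n m : ℕ} (A : Matrix (Fin n) (Fin n) ℝ)
    (B : Matrix (Fin n) (Fin m) ℝ) : Prop :=
  ∀ z : ℂ, Polynomial.aeval z (uncontrollablePart A B).charpoly = 0 → ‖z‖ < 1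

/-- The set dynamics `P ↦ P_x (C* ⊕ (A B)ᵀ P*)*`, where `P_x = (I O)` is the projection
`(x, u) ↦ x`. -/
def setDynamics {n m : ℕ} (A : Matrix (Fin n) (Fin n) ℝ) (B : Matrix (Fin n) (Fin m) ℝ)
    (C : Set (EuclideanSpace ℝ (Fin n ⊕ Fin m))) (P : Set (EuclideanSpace ℝ (Fin n))) :
    Set (EuclideanSpace ℝ (Fin n)) :=
  matImage (Matrix.fromCols (1 : Matrix (Fin n) (Fin n) ℝ) (0 : Matrix (Fin n) (Fin m) ℝ))
    (polarSet (polarSet C + matImage (Matrix.fromCols A B).transpose (polarSet P)))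

/-- The states of the set dynamics: the sets, containing the origin, whose polar is a `C`-set.
Unbounded sets such as the whole space (polar `{0}`) are included. -/
def polarCSetStates (n : ℕ) : Set (Set (EuclideanSpace ℝ (Fin n))) :=
  {P | (0 : EuclideanSpace ℝ (Fin n)) ∈ P ∧ IsCSet (polarSet P)}

/-- The states in `S` whose trajectory under `F` converges to `Q` in the Hausdorff distance. -/
def domainOfAttraction {E : Type*} [PseudoEMetricSpace E] (F : Set E → Set E) (S : Set (Set E))
    (Q : Set E) : Set (Set E) :=
  {P | P ∈ S ∧ Tendsto (fun k : ℕ => Metric.hausdorffEDist (F^[k] P) Q) atTop (𝓝 0)}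

/-- `Q` is an asymptotically stable attractor of `F` on the state space `S`, with respect to the
Hausdorff distance: it is Lyapunov stable and attracts all states in a neighbourhood of it. -/
def IsAsymptoticallyStableAttractor {E : Type*} [PseudoEMetricSpace E] (F : Set E → Set E)
    (S : Set (Set E)) (Q : Set E) : Prop :=
  (∀ ε : ℝ≥0∞, 0 < ε → ∃ δ : ℝ≥0∞, 0 < δ ∧ ∀ P ∈ S, Metric.hausdorffEDist P Q < δ →
      ∀ k : ℕ, Metric.hausdorffEDist (F^[k] P) Q < ε) ∧
  (∃ δ : ℝ≥0∞, 0 < δ ∧ ∀ P ∈ S, Metric.hausdorffEDist P Q < δ → P ∈ domainOfAttraction F S Q)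

/-- The vector `(x, u) ∈ ℝⁿ⁺ᵐ`. -/
def jointVec {n m : ℕ} (x : EuclideanSpace ℝ (Fin n)) (u : EuclideanSpace ℝ (Fin m)) :
    EuclideanSpace ℝ (Fin n ⊕ Fin m) :=
  WithLp.toLp 2 (Sum.elim x u)

/-- The objective `u ↦ ℓ(x, u) + V(A x + B u)`, with the stage cost `ℓ` the Minkowski function
of `C`. -/
def bellmanObjective {n m : ℕ} (A : Matrix (Fin n) (Fin n) ℝ) (B : Matrix (Fin n) (Fin m) ℝ)
    (C : Set (EuclideanSpace ℝ (Fin n ⊕ Fin m))) (V : EuclideanSpace ℝ (Fin n) → ℝ)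
    (x : EuclideanSpace ℝ (Fin n)) (u : EuclideanSpace ℝ (Fin m)) : ℝ :=
  gauge C (jointVec x u) + V (Matrix.toEuclideanLin A x + Matrix.toEuclideanLin B u)

/-- `(V, U)` solves the fixed point Minkowski–Bellman equation: for all `x`, `V x` is the
(attained) minimum of the objective over `u`, and `U x` is the set of its minimizers. -/
def IsMinkowskiBellmanFixedPoint {n m : ℕ} (A : Matrix (Fin n) (Fin n) ℝ)
    (B : Matrix (Fin n) (Fin m) ℝ) (C : Set (EuclideanSpace ℝ (Fin n ⊕ Fin m)))
    (V : EuclideanSpace ℝ (Fin n) → ℝ)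
    (U : EuclideanSpace ℝ (Fin n) → Set (EuclideanSpace ℝ (Fin m))) : Prop :=
  ∀ x, IsLeast (Set.range (bellmanObjective A B C V x)) (V x) ∧
    U x = {u | ∀ v, bellmanObjective A B C V x u ≤ bellmanObjective A B C V x v}

end

/-! ### Polars and Minkowski functions of `C`-sets. -/

section Polar

variable {ι : Type*} [Fintype ι]

/-! Polarity turns Minkowski sums into sums of Minkowski functions: the support function of `C* ⊕ (A
B)ᵀ P*` at `(x, u)` is `g_C(x, u) + g_{P**}(Ax + Bu)`, and projecting its unit sublevel set onto `x`
minimises over `u`. Hence the set dynamics is the Bellman operator acting on Minkowski functions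
(`gauge_setDynamics_le_iff`), and fixed sets correspond to Bellman fixed points
(`fixedPoint_iff_isLeast`).

Existence is value iteration from the zero function, that is, from the whole space. The iterates
decrease; stabilizability supplies controls that halve the state every `N` steps at a cost linear in
the norm, so a geometric series bounds the values and keeps a common ball inside all iterates
(`IsStrictlyStabilizable.exists_ball_subset`). Compactness of the sets of admissible controls makes
the intersection a fixed point.

Attraction comes from a contraction of relative errors (`exists_contraction`). Since `C` is bounded,
the cost-to-go `g_Q(Ax + Bu)` is at most a fraction `β < 1` of the total cost, and only this
fraction carries an error. Every state starts with a finite relative error, so convergence is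
global; uniqueness follows from it, and stability from comparing relative errors with Hausdorff
distances near `Q`. -/

theorem mem_polarSet_iff {X : Set (EuclideanSpace ℝ ι)} {x : EuclideanSpace ℝ ι} :
    x ∈ polarSet X ↔ ∀ y ∈ X, inner ℝ y x ≤ 1 := Iff.rfl

theorem polarSet_antitone {X Y : Set (EuclideanSpace ℝ ι)} (h : X ⊆ Y) :
    polarSet Y ⊆ polarSet X := fun _ hx y hy => hx y (h hy)

theorem zero_mem_polarSet (X : Set (EuclideanSpace ℝ ι)) : 0 ∈ polarSet X := by
  intro y _
  simp

theorem isClosed_polarSet (X : Set (EuclideanSpace ℝ ι)) : IsClosed (polarSet X) := by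
  have : polarSet X = ⋂ y ∈ X, {x | inner ℝ y x ≤ 1} := by
    ext x
    simp [mem_polarSet_iff]
  rw [this]
  exact isClosed_biInter fun y _ => isClosed_le (by fun_prop) continuous_const

theorem convex_polarSet (X : Set (EuclideanSpace ℝ ι)) : Convex ℝ (polarSet X) := by
  intro x hx z hz a b ha hb hab y hy
  rw [inner_add_right, inner_smul_right, inner_smul_right]
  nlinarith [hx y hy, hz y hy]

theorem subset_polarSet_polarSet (X : Set (EuclideanSpace ℝ ι)) :
    X ⊆ polarSet (polarSet X) := fun x hx y hy => by
  rw [real_inner_comm]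
  exact hy x hx

/-- The bipolar theorem. -/
theorem polarSet_polarSet_eq_self {X : Set (EuclideanSpace ℝ ι)} (hc : Convex ℝ X)
    (hX : IsClosed X) (h0 : 0 ∈ X) : polarSet (polarSet X) = X := by
  refine Set.Subset.antisymm (fun x hx => ?_) (subset_polarSet_polarSet X)
  by_contra hxX
  obtain ⟨f, u, hfu, hux⟩ := geometric_hahn_banach_closed_point hc hX hxX
  have hu : 0 < u := by simpa using hfu 0 h0
  set w := (InnerProductSpace.toDual ℝ (EuclideanSpace ℝ ι)).symm f with hw
  have hwf : ∀ y, inner ℝ w y = f y := fun y => by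
    rw [hw, InnerProductSpace.toDual_symm_apply]
  have hmem : u⁻¹ • w ∈ polarSet X := fun y hy => by
    rw [inner_smul_right, real_inner_comm, hwf, inv_mul_le_iff₀ hu]
    linarith [hfu y hy]
  have := hx _ hmem
  rw [real_inner_smul_left, hwf, inv_mul_le_iff₀ hu] at this
  linarith

theorem IsCSet.polarSet_mem_nhds {X : Set (EuclideanSpace ℝ ι)} (hX : IsCSet X) :
    polarSet X ∈ 𝓝 0 := by
  obtain ⟨R, hR, hXR⟩ := hX.1.isBounded.exists_pos_norm_le
  refine Metric.mem_nhds_iff.2 ⟨R⁻¹, inv_pos.2 hR, fun x hx y hy => ?_⟩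
  rw [mem_ball_zero_iff] at hx
  calc inner ℝ y x ≤ ‖y‖ * ‖x‖ := real_inner_le_norm y x
    _ ≤ R * R⁻¹ := by gcongr; exact hXR y hy
    _ = 1 := mul_inv_cancel₀ hR.ne'

theorem isBounded_polarSet {X : Set (EuclideanSpace ℝ ι)} (hX : X ∈ 𝓝 0) :
    Bornology.IsBounded (polarSet X) := by
  obtain ⟨r, hr, hrX⟩ := Metric.nhds_basis_closedBall.mem_iff.1 hX
  refine (Metric.isBounded_closedBall (x := 0) (r := r⁻¹)).subset fun x hx => ?_
  rw [mem_closedBall_zero_iff]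
  rcases eq_or_ne x 0 with rfl | hx0
  · simpa using hr.le
  have hn : 0 < ‖x‖ := norm_pos_iff.2 hx0
  have := hx ((r * ‖x‖⁻¹) • x) (hrX (by
    rw [mem_closedBall_zero_iff, norm_smul, Real.norm_of_nonneg (by positivity), mul_assoc,
      inv_mul_cancel₀ hn.ne', mul_one]))
  rw [real_inner_smul_left, real_inner_self_eq_norm_sq] at this
  rw [← one_div, le_div_iff₀ hr]
  calc ‖x‖ * r = r * ‖x‖⁻¹ * ‖x‖ ^ 2 := by field_simp
    _ ≤ 1 := this

theorem isCSet_polarSet {X : Set (EuclideanSpace ℝ ι)} (hX : X ∈ 𝓝 0) : IsCSet (polarSet X) :=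
  ⟨Metric.isCompact_of_isClosed_isBounded (isClosed_polarSet X) (isBounded_polarSet hX),
    convex_polarSet X, zero_mem_polarSet X⟩

theorem IsCSet.polarSet_polarSet {X : Set (EuclideanSpace ℝ ι)} (hX : IsCSet X) :
    polarSet (polarSet X) = X :=
  polarSet_polarSet_eq_self hX.2.1 hX.1.isClosed hX.2.2

theorem IsProperCSet.mem_nhds {X : Set (EuclideanSpace ℝ ι)} (hX : IsProperCSet X) : X ∈ 𝓝 0 :=
  mem_interior_iff_mem_nhds.1 hX.2

theorem IsProperCSet.absorbent {X : Set (EuclideanSpace ℝ ι)} (hX : IsProperCSet X) :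
    Absorbent ℝ X :=
  absorbent_nhds_zero hX.mem_nhds

/-- For a closed convex neighbourhood of the origin, the sublevel sets of the Minkowski function
are the dilations. -/
theorem gauge_le_iff_inv_smul_mem {X : Set (EuclideanSpace ℝ ι)} (hc : Convex ℝ X)
    (hX : IsClosed X) (h0 : X ∈ 𝓝 0) {t : ℝ} (ht : 0 < t) {x : EuclideanSpace ℝ ι} :
    gauge X x ≤ t ↔ t⁻¹ • x ∈ X := by
  conv_rhs => rw [← hX.closure_eq, ← gauge_le_one_iff_mem_closure hc h0,
    gauge_smul_of_nonneg (inv_nonneg.2 ht.le), smul_eq_mul, inv_mul_le_iff₀ ht, mul_one]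

theorem gauge_le_one_iff_mem {X : Set (EuclideanSpace ℝ ι)} (hc : Convex ℝ X)
    (hX : IsClosed X) (h0 : X ∈ 𝓝 0) {x : EuclideanSpace ℝ ι} :
    gauge X x ≤ 1 ↔ x ∈ X := by
  simpa using gauge_le_iff_inv_smul_mem hc hX h0 one_pos

theorem IsProperCSet.gauge_le_iff {X : Set (EuclideanSpace ℝ ι)} (hX : IsProperCSet X)
    {t : ℝ} (ht : 0 < t) {x : EuclideanSpace ℝ ι} : gauge X x ≤ t ↔ t⁻¹ • x ∈ X :=
  gauge_le_iff_inv_smul_mem hX.1.2.1 hX.1.1.isClosed hX.mem_nhds ht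

theorem IsProperCSet.gauge_le_one_iff {X : Set (EuclideanSpace ℝ ι)} (hX : IsProperCSet X)
    {x : EuclideanSpace ℝ ι} : gauge X x ≤ 1 ↔ x ∈ X :=
  gauge_le_one_iff_mem hX.1.2.1 hX.1.1.isClosed hX.mem_nhds

theorem IsProperCSet.gauge_injective {X Y : Set (EuclideanSpace ℝ ι)} (hX : IsProperCSet X)
    (hY : IsProperCSet Y) (h : gauge X = gauge Y) : X = Y := by
  ext x
  rw [← hX.gauge_le_one_iff, h, hY.gauge_le_one_iff]

/-- Sublevel sets of a Minkowski function are dilations only at positive levels; this carries such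
descriptions over to level zero. -/
theorem le_of_forall_pos_imp_le {a b : ℝ} (hb : 0 ≤ b)
    (h : ∀ s, 0 < s → b ≤ s → a ≤ s) : a ≤ b :=
  le_of_forall_gt_imp_ge_of_dense fun s hs => h s (hb.trans_lt hs) hs.le

/-- The Minkowski function of the polar of a `C`-set is its support function. -/
theorem IsCSet.gauge_polarSet_le_iff {W : Set (EuclideanSpace ℝ ι)} (hW : IsCSet W)
    {t : ℝ} {x : EuclideanSpace ℝ ι} :
    gauge (polarSet W) x ≤ t ↔ ∀ w ∈ W, inner ℝ w x ≤ t := by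
  have key : ∀ s : ℝ, 0 < s → (gauge (polarSet W) x ≤ s ↔ ∀ w ∈ W, inner ℝ w x ≤ s) := by
    intro s hs
    rw [gauge_le_iff_inv_smul_mem (convex_polarSet W) (isClosed_polarSet W)
      hW.polarSet_mem_nhds hs, mem_polarSet_iff]
    refine forall₂_congr fun w _ => ?_
    rw [inner_smul_right, inv_mul_le_iff₀ hs, mul_one]
  constructor
  · intro h w hw
    exact le_of_forall_pos_imp_le ((gauge_nonneg _).trans h)
      fun s hs hts => (key s hs).1 (h.trans hts) w hw
  · intro h
    have ht : 0 ≤ t := by simpa using h 0 hW.2.2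
    exact le_of_forall_pos_imp_le ht
      fun s hs hts => (key s hs).2 fun w hw => (h w hw).trans hts

theorem IsCSet.inner_le_gauge_polarSet {W : Set (EuclideanSpace ℝ ι)} (hW : IsCSet W)
    {w x : EuclideanSpace ℝ ι} (hw : w ∈ W) : inner ℝ w x ≤ gauge (polarSet W) x :=
  hW.gauge_polarSet_le_iff.1 le_rfl w hw

theorem IsProperCSet.isCSet_polarSet {X : Set (EuclideanSpace ℝ ι)} (hX : IsProperCSet X) :
    IsCSet (polarSet X) := _root_.isCSet_polarSet hX.mem_nhds

theorem IsProperCSet.exists_norm_le {X : Set (EuclideanSpace ℝ ι)} (hX : IsProperCSet X) :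
    ∃ R : ℝ, 0 < R ∧ ∀ x, ‖x‖ ≤ R * gauge X x := by
  obtain ⟨R, hR, hXR⟩ := hX.1.1.isBounded.exists_pos_norm_le
  refine ⟨R, hR, fun x => ?_⟩
  have := le_gauge_of_subset_closedBall hX.absorbent hR.le (x := x)
    (fun y hy => mem_closedBall_zero_iff.2 (hXR y hy))
  rwa [div_le_iff₀ hR, mul_comm] at this

theorem exists_gauge_le {X : Set (EuclideanSpace ℝ ι)} (hX : X ∈ 𝓝 0) :
    ∃ K : ℝ, 0 < K ∧ ∀ x, gauge X x ≤ K * ‖x‖ := by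
  obtain ⟨r, hr, hrX⟩ := Metric.mem_nhds_iff.1 hX
  refine ⟨r⁻¹, inv_pos.2 hr, fun x => ?_⟩
  rw [← div_eq_inv_mul, le_div_iff₀ hr, mul_comm]
  exact mul_gauge_le_norm hrX

theorem IsProperCSet.of_bounds {X : Set (EuclideanSpace ℝ ι)} (hX : IsCompact X)
    (hc : Convex ℝ X) {r : ℝ} (hr : 0 < r) (h : ∀ x, ‖x‖ ≤ r → x ∈ X) : IsProperCSet X :=
  ⟨⟨hX, hc, h 0 (by simpa using hr.le)⟩, mem_interior_iff_mem_nhds.2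
    (mem_of_superset (Metric.closedBall_mem_nhds 0 hr)
      fun x hx => h x (mem_closedBall_zero_iff.1 hx))⟩

end Polar

/-! ### Stabilizability: linear open-loop controls that halve the state. -/

section Stabilizable

attribute [local instance] Matrix.linftyOpNormedRing Matrix.linftyOpNormedAlgebra

/-- The powers of an element of a complex Banach algebra with spectrum in the open unit disc
converge to zero. -/
theorem tendsto_pow_zero_of_spectrum {A : Type*} [NormedRing A] [NormedAlgebra ℂ A]
    [CompleteSpace A] (a : A) (ha : ∀ z ∈ spectrum ℂ a, ‖z‖ < 1) :
    Tendsto (fun k : ℕ => a ^ k) atTop (𝓝 0) := by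
  rcases subsingleton_or_nontrivial A with h | h
  · exact tendsto_const_nhds.congr fun k => Subsingleton.elim _ _
  have hρ : spectralRadius ℂ a < (1 : NNReal) :=
    spectrum.spectralRadius_lt_of_forall_lt a fun z hz => by exact_mod_cast ha z hz
  obtain ⟨q, hq, hq1⟩ := ENNReal.lt_iff_exists_nnreal_btwn.1 hρ
  have hq1 : (q : ℝ) < 1 := by exact_mod_cast hq1
  -- Gelfand's formula: `‖a ^ k‖ ^ (1 / k)` tends to the spectral radius, so it is eventually below
  -- `q < 1`.
  have hev := (spectrum.pow_nnnorm_pow_one_div_tendsto_nhds_spectralRadius a).eventually_lt_const hq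
  refine squeeze_zero_norm' ?_ (tendsto_pow_atTop_nhds_zero_of_lt_one q.2 hq1)
  filter_upwards [hev, eventually_gt_atTop 0] with k hk hk0
  have hk0' : (0 : ℝ) < k := by exact_mod_cast hk0
  have h1 : (‖a ^ k‖₊ : ℝ≥0∞) ≤ (q : ℝ≥0∞) ^ k := by
    have := ENNReal.rpow_le_rpow hk.le hk0'.le
    rwa [← ENNReal.rpow_mul, one_div, inv_mul_cancel₀ hk0'.ne', ENNReal.rpow_one,
      ENNReal.rpow_natCast] at this
  exact_mod_cast h1

theorem Matrix.tendsto_pow_zero_of_charpoly {ι : Type*} [Fintype ι] [DecidableEq ι]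
    (M : Matrix ι ι ℝ) (hM : ∀ z : ℂ, Polynomial.aeval z M.charpoly = 0 → ‖z‖ < 1) :
    Tendsto (fun k : ℕ => M ^ k) atTop (𝓝 0) := by
  have h := tendsto_pow_zero_of_spectrum (M.map (algebraMap ℝ ℂ)) fun z hz => hM z (by
    rw [Matrix.mem_spectrum_iff_isRoot_charpoly, Matrix.charpoly_map, Polynomial.IsRoot,
      Polynomial.eval_map_algebraMap] at hz
    exact hz)
  refine tendsto_pi_nhds.2 fun i => tendsto_pi_nhds.2 fun j => ?_
  have h := ((continuous_id.matrix_elem i j).tendsto 0).comp h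
  have := (Complex.continuous_re.tendsto _).comp h
  refine (this.congr fun k => ?_).trans (by simp)
  have : M.map (algebraMap ℝ ℂ) ^ k = (M ^ k).map (algebraMap ℝ ℂ) :=
    (map_pow (algebraMap ℝ ℂ).mapMatrix M k).symm
  change ((M.map (algebraMap ℝ ℂ) ^ k) i j).re = _
  rw [this]
  simp

variable {n m : ℕ} (A : Matrix (Fin n) (Fin n) ℝ) (B : Matrix (Fin n) (Fin m) ℝ)

/-- The subspace of the states reachable from the origin in `N` steps. -/
noncomputable def reachableSubspace : ℕ → Submodule ℝ (EuclideanSpace ℝ (Fin n))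
  | 0 => ⊥
  | N + 1 => LinearMap.range (Matrix.toEuclideanLin B) ⊔
      (reachableSubspace N).map (Matrix.toEuclideanLin A)

theorem reachableSubspace_mono : Monotone (reachableSubspace A B) := by
  refine monotone_nat_of_le_succ fun N => ?_
  induction N with
  | zero => exact bot_le
  | succ N ih => exact sup_le_sup le_rfl (Submodule.map_mono ih)

theorem range_pow_mul_le_reachableSubspace (k : ℕ) :
    LinearMap.range (Matrix.toEuclideanLin (A ^ k * B)) ≤ reachableSubspace A B (k + 1) := by
  induction k with
  | zero => simp [reachableSubspace]
  | succ k ih =>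
    refine le_trans ?_ (le_sup_right : _ ≤ reachableSubspace A B (k + 2))
    have : Matrix.toEuclideanLin (A ^ (k + 1) * B) =
        (Matrix.toEuclideanLin A).comp (Matrix.toEuclideanLin (A ^ k * B)) := by
      ext u : 1
      simp [Matrix.toLpLin_apply, pow_succ', Matrix.mul_assoc]
    rw [this, LinearMap.range_comp]
    exact Submodule.map_mono ih

/-- The reachable subspaces increase, so by Noetherianity they are constant from some time on. All
larger `N` are covered because the horizon must later also be long enough for contraction. -/
theorem exists_controllableSubspace_le_reachableSubspace :
    ∃ N₀, ∀ N ≥ N₀, controllableSubspace A B ≤ reachableSubspace A B N := by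
  obtain ⟨N₀, h⟩ := monotone_stabilizes_iff_noetherian.2 inferInstance
    (⟨reachableSubspace A B, reachableSubspace_mono A B⟩ :
      ℕ →o Submodule ℝ (EuclideanSpace ℝ (Fin n)))
  have h : ∀ N, N₀ ≤ N → reachableSubspace A B N₀ = reachableSubspace A B N := h
  refine ⟨N₀, fun N hN => iSup_le fun k => (range_pow_mul_le_reachableSubspace A B k).trans ?_⟩
  rw [← h N hN]
  rcases le_total (k + 1) N₀ with hk | hk
  · exact reachableSubspace_mono A B hk
  · exact (h _ hk).ge

/-- `StepMap A B N L` means that linear (time-varying, open-loop) controls steer every initial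
state `x` to `L x` in `N` steps. -/
inductive StepMap : ℕ → (EuclideanSpace ℝ (Fin n) →ₗ[ℝ] EuclideanSpace ℝ (Fin n)) → Prop
  | zero : StepMap 0 LinearMap.id
  | succ {N : ℕ} {L : EuclideanSpace ℝ (Fin n) →ₗ[ℝ] EuclideanSpace ℝ (Fin n)}
      (K : EuclideanSpace ℝ (Fin n) →ₗ[ℝ] EuclideanSpace ℝ (Fin m)) (h : StepMap N L) :
      StepMap (N + 1) (Matrix.toEuclideanLin A ∘ₗ L + Matrix.toEuclideanLin B ∘ₗ K)

theorem LinearMap.exists_comp_eq_of_range_le {K V W E : Type*} [Field K] [AddCommGroup V]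
    [Module K V] [AddCommGroup W] [Module K W] [AddCommGroup E] [Module K E]
    (f : V →ₗ[K] W) (g : E →ₗ[K] W) (h : LinearMap.range g ≤ LinearMap.range f) :
    ∃ k : E →ₗ[K] V, f ∘ₗ k = g := by
  obtain ⟨k, hk⟩ := Module.projective_lifting_property f.rangeRestrict
    (g.codRestrict (LinearMap.range f) fun x => h ⟨x, rfl⟩) f.surjective_rangeRestrict
  refine ⟨k, LinearMap.ext fun x => ?_⟩
  simpa using congrArg Subtype.val (LinearMap.congr_fun hk x)

/-- Controls add to the free response `A ^ N` any linear correction with reachable values. In the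
induction, `R` is lifted linearly to a last input plus `A` applied to a correction reachable in `N`
steps. -/
theorem stepMap_of_range_le (N : ℕ)
    (R : EuclideanSpace ℝ (Fin n) →ₗ[ℝ] EuclideanSpace ℝ (Fin n))
    (hR : LinearMap.range R ≤ reachableSubspace A B N) :
    StepMap A B N (Matrix.toEuclideanLin A ^ N + R) := by
  induction N generalizing R with
  | zero =>
    have : R = 0 := LinearMap.range_eq_bot.1 (le_bot_iff.1 hR)
    subst this
    simpa [Module.End.one_eq_id] using StepMap.zero (A := A) (B := B)
  | succ N ih =>
    obtain ⟨k, hk⟩ := LinearMap.exists_comp_eq_of_range_le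
      ((Matrix.toEuclideanLin B).coprod
        (Matrix.toEuclideanLin A ∘ₗ (reachableSubspace A B N).subtype)) R (by
        rw [LinearMap.range_coprod, LinearMap.range_comp, Submodule.range_subtype]
        exact hR)
    have h := (ih ((reachableSubspace A B N).subtype ∘ₗ LinearMap.snd ℝ _ _ ∘ₗ k) (by
      rintro _ ⟨x, rfl⟩
      simp)).succ (LinearMap.fst ℝ _ _ ∘ₗ k)
    convert h using 1
    rw [← hk]
    ext x : 1
    simp only [pow_succ', LinearMap.add_apply, Module.End.mul_apply, LinearMap.comp_apply,
      LinearMap.coprod_apply, map_add, LinearMap.fst_apply, LinearMap.snd_apply]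
    abel

/-- A strictly stabilizable system can be steered so that the norm of the state is halved. -/
theorem IsStrictlyStabilizable.exists_stepMap (h : IsStrictlyStabilizable A B) :
    ∃ N L, 0 < N ∧ StepMap A B N L ∧ ∀ x, ‖L x‖ ≤ 2⁻¹ * ‖x‖ := by
  obtain ⟨N₀, hN₀⟩ := exists_controllableSubspace_le_reachableSubspace A B
  set Q := controllableSubspace A B
  set b := Module.finBasis ℝ (EuclideanSpace ℝ (Fin n) ⧸ Q)
  set M := LinearMap.toMatrix b b (uncontrollablePart A B) with hM
  have hlim : Tendsto (fun k : ℕ => M ^ k) atTop (𝓝 0) :=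
    Matrix.tendsto_pow_zero_of_charpoly M fun z hz => h z (by
      rwa [hM, LinearMap.charpoly_toMatrix] at hz)
  obtain ⟨s, hs⟩ := Q.mkQ.exists_rightInverse_of_surjective Q.range_mkQ
  -- `Φ` conjugates a map of the quotient to a map of the state space through the section `s`. It is
  -- linear on a finite-dimensional space, hence continuous, so `Φ (M ^ k)` tends to zero.
  let Φ : Matrix _ _ ℝ →ₗ[ℝ] (EuclideanSpace ℝ (Fin n) →L[ℝ] EuclideanSpace ℝ (Fin n)) :=
    LinearMap.toContinuousLinearMap.toLinearMap ∘ₗ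
      (LinearMap.lcomp ℝ _ Q.mkQ) ∘ₗ (LinearMap.llcomp ℝ _ _ _ s) ∘ₗ
        (Matrix.toLin b b).toLinearMap
  have hΦ : Tendsto (fun k : ℕ => Φ (M ^ k)) atTop (𝓝 0) := by
    have := (Φ.continuous_of_finiteDimensional.tendsto 0).comp hlim
    rwa [map_zero] at this
  have hev : ∀ᶠ k in atTop, ‖Φ (M ^ k)‖ < 2⁻¹ :=
    (tendsto_zero_iff_norm_tendsto_zero.1 hΦ).eventually_lt_const (by norm_num)
  obtain ⟨N, hN, hNN⟩ := (hev.and (eventually_ge_atTop (N₀ + 1))).exists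
  set L := s ∘ₗ (uncontrollablePart A B ^ N) ∘ₗ Q.mkQ with hL
  have hΦL : ∀ x, Φ (M ^ N) x = L x := by
    intro x
    have : Matrix.toLin b b (M ^ N) = uncontrollablePart A B ^ N := by
      rw [hM, LinearMap.toMatrix_pow, Matrix.toLin_toMatrix]
    simp [Φ, this, hL]
  refine ⟨N, L, by omega, ?_, fun x => ?_⟩
  -- Modulo the controllable subspace `L` agrees with `A ^ N`, so their difference is a reachable
  -- correction.
  · have := stepMap_of_range_le A B N (L - Matrix.toEuclideanLin A ^ N) (by
      refine le_trans ?_ (hN₀ N (by omega))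
      rintro _ ⟨x, rfl⟩
      rw [← Submodule.ker_mkQ Q, LinearMap.mem_ker]
      have h1 : ∀ y, Q.mkQ (s y) = y := fun y => LinearMap.congr_fun hs y
      have h2 : ∀ (k : ℕ) x, Q.mkQ ((Matrix.toEuclideanLin A ^ k) x) =
          (uncontrollablePart A B ^ k) (Q.mkQ x) := by
        intro k
        induction k with
        | zero => simp
        | succ k ih =>
          intro x
          rw [pow_succ', pow_succ', Module.End.mul_apply, Module.End.mul_apply, ← ih]
          rfl
      rw [LinearMap.sub_apply, map_sub, h2, hL, LinearMap.comp_apply, LinearMap.comp_apply, h1,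
        sub_self])
    simpa using this
  · rw [← hΦL]
    exact (Φ (M ^ N)).le_of_opNorm_le hN.le x

end Stabilizable

/-! ### The set dynamics as the Bellman operator. -/

section BellmanOperator

variable {n m : ℕ} {A : Matrix (Fin n) (Fin n) ℝ} {B : Matrix (Fin n) (Fin m) ℝ}
  {C : Set (EuclideanSpace ℝ (Fin n ⊕ Fin m))} {P : Set (EuclideanSpace ℝ (Fin n))}

theorem jointVec_surjective (p : EuclideanSpace ℝ (Fin n ⊕ Fin m)) :
    ∃ x u, jointVec x u = p :=
  ⟨WithLp.toLp 2 fun i => p (Sum.inl i), WithLp.toLp 2 fun i => p (Sum.inr i), by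
    ext (i | i) <;> simp [jointVec]⟩

theorem jointVec_smul (t : ℝ) (x : EuclideanSpace ℝ (Fin n)) (u : EuclideanSpace ℝ (Fin m)) :
    jointVec (t • x) (t • u) = t • jointVec x u := by
  ext (i | i) <;> simp [jointVec]

theorem norm_sq_jointVec (x : EuclideanSpace ℝ (Fin n)) (u : EuclideanSpace ℝ (Fin m)) :
    ‖jointVec x u‖ ^ 2 = ‖x‖ ^ 2 + ‖u‖ ^ 2 := by
  simp [EuclideanSpace.norm_sq_eq, jointVec]

theorem norm_fst_le_norm_jointVec (x : EuclideanSpace ℝ (Fin n))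
    (u : EuclideanSpace ℝ (Fin m)) : ‖x‖ ≤ ‖jointVec x u‖ := by
  have := norm_sq_jointVec x u
  exact le_of_sq_le_sq (by nlinarith [sq_nonneg ‖u‖]) (norm_nonneg _)

theorem norm_snd_le_norm_jointVec (x : EuclideanSpace ℝ (Fin n))
    (u : EuclideanSpace ℝ (Fin m)) : ‖u‖ ≤ ‖jointVec x u‖ := by
  have := norm_sq_jointVec x u
  exact le_of_sq_le_sq (by nlinarith [sq_nonneg ‖x‖]) (norm_nonneg _)

theorem norm_jointVec_le (x : EuclideanSpace ℝ (Fin n)) (u : EuclideanSpace ℝ (Fin m)) :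
    ‖jointVec x u‖ ≤ ‖x‖ + ‖u‖ := by
  have := norm_sq_jointVec x u
  exact le_of_sq_le_sq (by nlinarith [mul_nonneg (norm_nonneg x) (norm_nonneg u)])
    (by positivity)

theorem continuous_jointVec (x : EuclideanSpace ℝ (Fin n)) :
    Continuous fun u : EuclideanSpace ℝ (Fin m) => jointVec x u := by
  refine (PiLp.continuous_toLp 2 _).comp (continuous_pi fun i => ?_)
  rcases i with i | i <;> simp <;> fun_prop

theorem toEuclideanLin_fromCols_jointVec {k : ℕ} (A : Matrix (Fin k) (Fin n) ℝ)
    (B : Matrix (Fin k) (Fin m) ℝ) (x : EuclideanSpace ℝ (Fin n))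
    (u : EuclideanSpace ℝ (Fin m)) :
    Matrix.toEuclideanLin (Matrix.fromCols A B) (jointVec x u) =
      Matrix.toEuclideanLin A x + Matrix.toEuclideanLin B u := by
  ext i
  simp [Matrix.toLpLin_apply, jointVec, Matrix.fromCols_mulVec]

theorem inner_toEuclideanLin_transpose {ι κ : Type*} [Fintype ι] [DecidableEq ι] [Fintype κ]
    [DecidableEq κ] (M : Matrix κ ι ℝ) (w : EuclideanSpace ℝ κ) (p : EuclideanSpace ℝ ι) :
    inner ℝ (Matrix.toEuclideanLin M.transpose w) p = inner ℝ w (Matrix.toEuclideanLin M p) := by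
  rw [← Matrix.conjTranspose_eq_transpose_of_trivial,
    Matrix.toEuclideanLin_conjTranspose_eq_adjoint, LinearMap.adjoint_inner_left]

theorem IsProperCSet.mem_polarCSetStates (hP : IsProperCSet P) : P ∈ polarCSetStates n :=
  ⟨hP.1.2.2, hP.isCSet_polarSet⟩

theorem IsProperCSet.polarSet_polarSet (hP : IsProperCSet P) : polarSet (polarSet P) = P :=
  hP.1.polarSet_polarSet

/-- The polar inside the set dynamics is the unit sublevel set of the Bellman objective. -/
theorem jointVec_mem_polarSet_add_iff (hC : IsProperCSet C) (hP : P ∈ polarCSetStates n)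
    (x : EuclideanSpace ℝ (Fin n)) (u : EuclideanSpace ℝ (Fin m)) :
    jointVec x u ∈ polarSet (polarSet C + matImage (Matrix.fromCols A B).transpose (polarSet P)) ↔
      bellmanObjective A B C (gauge (polarSet (polarSet P))) x u ≤ 1 := by
  have hC' := hC.isCSet_polarSet
  have hgC : ∀ {t : ℝ} {p}, gauge C p ≤ t ↔ ∀ c ∈ polarSet C, inner ℝ c p ≤ t := by
    intro t p
    rw [← hC'.gauge_polarSet_le_iff, hC.1.polarSet_polarSet]
  have hin : ∀ w : EuclideanSpace ℝ (Fin n),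
      inner ℝ (Matrix.toEuclideanLin (Matrix.fromCols A B).transpose w) (jointVec x u) =
        inner ℝ w (Matrix.toEuclideanLin A x + Matrix.toEuclideanLin B u) := fun w => by
    rw [inner_toEuclideanLin_transpose, toEuclideanLin_fromCols_jointVec]
  unfold bellmanObjective
  constructor
  · intro h
    -- The supremum over pairs splits: with `w` fixed, the supremum over `c` gives `gauge C`; the
    -- supremum over `w` then gives the other Minkowski function.
    have h1 : ∀ w ∈ polarSet P,
        gauge C (jointVec x u) ≤
          1 - inner ℝ w (Matrix.toEuclideanLin A x + Matrix.toEuclideanLin B u) := by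
      intro w hw
      refine hgC.2 fun c hc => ?_
      have := h _ (Set.add_mem_add hc ⟨w, hw, rfl⟩)
      rw [inner_add_left, hin] at this
      linarith
    have h2 := (hP.2.gauge_polarSet_le_iff (t := 1 - gauge C (jointVec x u))
      (x := Matrix.toEuclideanLin A x + Matrix.toEuclideanLin B u)).2 fun w hw => by
        linarith [h1 w hw]
    linarith
  · rintro h _ ⟨c, hc, _, ⟨w, hw, rfl⟩, rfl⟩
    simp only
    rw [inner_add_left, hin]
    linarith [hgC.1 (le_refl (gauge C (jointVec x u))) c hc, hP.2.inner_le_gauge_polarSet hw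
      (x := Matrix.toEuclideanLin A x + Matrix.toEuclideanLin B u)]

theorem mem_setDynamics_iff (hC : IsProperCSet C) (hP : P ∈ polarCSetStates n)
    (x : EuclideanSpace ℝ (Fin n)) :
    x ∈ setDynamics A B C P ↔
      ∃ u, bellmanObjective A B C (gauge (polarSet (polarSet P))) x u ≤ 1 := by
  have hproj : ∀ (y : EuclideanSpace ℝ (Fin n)) (u : EuclideanSpace ℝ (Fin m)),
      Matrix.toEuclideanLin (Matrix.fromCols (1 : Matrix (Fin n) (Fin n) ℝ)
        (0 : Matrix (Fin n) (Fin m) ℝ)) (jointVec y u) = y := fun y u => by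
    rw [toEuclideanLin_fromCols_jointVec]
    simp
  constructor
  · rintro ⟨p, hp, rfl⟩
    obtain ⟨y, u, rfl⟩ := jointVec_surjective p
    refine ⟨u, ?_⟩
    simp only [hproj]
    exact (jointVec_mem_polarSet_add_iff hC hP y u).1 hp
  · rintro ⟨u, hu⟩
    exact ⟨jointVec x u, (jointVec_mem_polarSet_add_iff hC hP x u).2 hu, hproj x u⟩

theorem bellmanObjective_smul (Q : Set (EuclideanSpace ℝ (Fin n))) {t : ℝ} (ht : 0 ≤ t)
    (x : EuclideanSpace ℝ (Fin n)) (u : EuclideanSpace ℝ (Fin m)) :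
    bellmanObjective A B C (gauge Q) (t • x) (t • u) =
      t * bellmanObjective A B C (gauge Q) x u := by
  unfold bellmanObjective
  rw [jointVec_smul, map_smul, map_smul, ← smul_add, gauge_smul_of_nonneg ht,
    gauge_smul_of_nonneg ht, smul_eq_mul, smul_eq_mul, mul_add]

theorem exists_norm_linearMap_le {k l : ℕ}
    (f : EuclideanSpace ℝ (Fin k) →ₗ[ℝ] EuclideanSpace ℝ (Fin l)) :
    ∃ K : ℝ, 0 < K ∧ ∀ x, ‖f x‖ ≤ K * ‖x‖ :=
  f.toContinuousLinearMap.bound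

/-- The set dynamics maps every state to a proper `C`-set. -/
theorem isProperCSet_setDynamics (A : Matrix (Fin n) (Fin n) ℝ) (B : Matrix (Fin n) (Fin m) ℝ)
    (hC : IsProperCSet C) (hP : P ∈ polarCSetStates n) :
    IsProperCSet (setDynamics A B C P) := by
  set S := polarSet C + matImage (Matrix.fromCols A B).transpose (polarSet P) with hS
  have hCS : polarSet S ⊆ C := by
    rw [← hC.1.polarSet_polarSet]
    refine polarSet_antitone fun c hc => ?_
    have : c + Matrix.toEuclideanLin (Matrix.fromCols A B).transpose 0 ∈ S :=
      Set.add_mem_add hc ⟨0, zero_mem_polarSet P, rfl⟩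
    simpa using this
  have hcomp : IsCompact (polarSet S) := hC.1.1.of_isClosed_subset (isClosed_polarSet S) hCS
  obtain ⟨K₁, hK₁, h₁⟩ := exists_gauge_le hC.mem_nhds
  obtain ⟨K₂, hK₂, h₂⟩ := exists_gauge_le hP.2.polarSet_mem_nhds
  obtain ⟨K₃, hK₃, h₃⟩ := exists_norm_linearMap_le (Matrix.toEuclideanLin A)
  have hK : 0 < K₁ + K₂ * K₃ := by positivity
  refine IsProperCSet.of_bounds (hcomp.image (LinearMap.continuous_of_finiteDimensional _))
    ((convex_polarSet S).linear_image _) (inv_pos.2 hK) fun x hx => ?_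
  -- The zero control already has cost at most `(K₁ + K₂ * K₃) * ‖x‖`, whence the radius of the
  -- ball.
  refine (mem_setDynamics_iff hC hP x).2 ⟨0, ?_⟩
  have hx0 : ‖jointVec x (0 : EuclideanSpace ℝ (Fin m))‖ ≤ ‖x‖ := by
    simpa using norm_jointVec_le x (0 : EuclideanSpace ℝ (Fin m))
  calc bellmanObjective A B C (gauge (polarSet (polarSet P))) x 0
      ≤ K₁ * ‖x‖ + K₂ * (K₃ * ‖x‖) := by
        unfold bellmanObjective
        rw [map_zero, add_zero]
        gcongr
        · exact (h₁ _).trans (by gcongr)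
        · exact (h₂ _).trans (by gcongr; exact h₃ x)
    _ = ‖x‖ * (K₁ + K₂ * K₃) := by ring
    _ ≤ (K₁ + K₂ * K₃)⁻¹ * (K₁ + K₂ * K₃) := by gcongr
    _ = 1 := inv_mul_cancel₀ hK.ne'

/-- The Minkowski function of the image under the set dynamics is the value of the Bellman
operator, and the minimum is attained. -/
theorem gauge_setDynamics_le_iff (hC : IsProperCSet C) (hP : P ∈ polarCSetStates n)
    {t : ℝ} {x : EuclideanSpace ℝ (Fin n)} :
    gauge (setDynamics A B C P) x ≤ t ↔
      ∃ u, bellmanObjective A B C (gauge (polarSet (polarSet P))) x u ≤ t := by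
  have hF := isProperCSet_setDynamics A B hC hP
  have hnn : ∀ x u, 0 ≤ bellmanObjective A B C (gauge (polarSet (polarSet P))) x u :=
    fun x u => add_nonneg (gauge_nonneg _) (gauge_nonneg _)
  have key : ∀ s : ℝ, 0 < s → ∀ x, (gauge (setDynamics A B C P) x ≤ s ↔
      ∃ u, bellmanObjective A B C (gauge (polarSet (polarSet P))) x u ≤ s) := by
    intro s hs x
    rw [hF.gauge_le_iff hs, mem_setDynamics_iff hC hP]
    constructor
    · rintro ⟨u, hu⟩
      refine ⟨s • u, ?_⟩
      have := bellmanObjective_smul (A := A) (B := B) (C := C) (polarSet (polarSet P)) hs.le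
        (s⁻¹ • x) u
      rw [smul_inv_smul₀ hs.ne'] at this
      rw [this]
      nlinarith
    · rintro ⟨u, hu⟩
      refine ⟨s⁻¹ • u, ?_⟩
      rwa [bellmanObjective_smul _ (inv_nonneg.2 hs.le), inv_mul_le_iff₀ hs, mul_one]
  constructor
  · intro h
    -- Homogeneity settles positive levels; at level zero boundedness forces `x = 0`, and the zero
    -- control is optimal.
    rcases ((gauge_nonneg _).trans h).eq_or_lt with ht | ht
    · obtain ⟨R, hR, hRx⟩ := hF.exists_norm_le
      have hx : x = 0 := norm_le_zero_iff.1 ((hRx x).trans (by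
        rw [← ht] at h
        nlinarith))
      subst hx
      refine ⟨0, ?_⟩
      have := bellmanObjective_smul (A := A) (B := B) (C := C) (polarSet (polarSet P)) le_rfl 0 0
      rw [smul_zero, smul_zero, zero_mul] at this
      rw [this, ht]
    · exact (key t ht x).1 h
  · rintro ⟨u, hu⟩
    exact le_of_forall_pos_imp_le ((hnn x u).trans hu)
      fun s hs hts => (key s hs x).2 ⟨u, hu.trans hts⟩

theorem setDynamics_mono (A : Matrix (Fin n) (Fin n) ℝ) (B : Matrix (Fin n) (Fin m) ℝ)
    (C : Set (EuclideanSpace ℝ (Fin n ⊕ Fin m))) : Monotone (setDynamics A B C) :=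
  fun _ _ h => Set.image_mono (polarSet_antitone (Set.add_subset_add_left
    (Set.image_mono (polarSet_antitone h))))

end BellmanOperator

/-! ### Existence of the fixed point by value iteration from the whole space. -/

section FixedPoint

variable {n m : ℕ} {A : Matrix (Fin n) (Fin n) ℝ} {B : Matrix (Fin n) (Fin m) ℝ}
  {C : Set (EuclideanSpace ℝ (Fin n ⊕ Fin m))} {P : Set (EuclideanSpace ℝ (Fin n))}

theorem setDynamics_mem_polarCSetStates (hC : IsProperCSet C) (hP : P ∈ polarCSetStates n) :
    setDynamics A B C P ∈ polarCSetStates n :=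
  (isProperCSet_setDynamics A B hC hP).mem_polarCSetStates

theorem iterate_setDynamics_mem_polarCSetStates (hC : IsProperCSet C)
    (hP : P ∈ polarCSetStates n) (k : ℕ) : (setDynamics A B C)^[k] P ∈ polarCSetStates n := by
  induction k with
  | zero => exact hP
  | succ k ih =>
    rw [Function.iterate_succ_apply']
    exact setDynamics_mem_polarCSetStates hC ih

theorem isProperCSet_iterate_setDynamics (hC : IsProperCSet C)
    (hP : P ∈ polarCSetStates n) (k : ℕ) : IsProperCSet ((setDynamics A B C)^[k + 1] P) := by
  rw [Function.iterate_succ_apply']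
  exact isProperCSet_setDynamics A B hC (iterate_setDynamics_mem_polarCSetStates hC hP k)

theorem polarSet_univ : polarSet (Set.univ : Set (EuclideanSpace ℝ (Fin n))) = {0} := by
  refine Set.Subset.antisymm (fun x hx => ?_) (by simpa using zero_mem_polarSet _)
  by_contra h
  have hn : 0 < ‖x‖ ^ 2 := by
    have : 0 < ‖x‖ := norm_pos_iff.2 h
    positivity
  have := hx ((2 * (‖x‖ ^ 2)⁻¹) • x) (Set.mem_univ _)
  rw [real_inner_smul_left, real_inner_self_eq_norm_sq, mul_assoc, inv_mul_cancel₀ hn.ne'] at this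
  norm_num at this

theorem univ_mem_polarCSetStates : Set.univ ∈ polarCSetStates n :=
  ⟨Set.mem_univ _, by
    rw [polarSet_univ]
    exact ⟨isCompact_singleton, convex_singleton 0, rfl⟩⟩

/-- Steering a state `x` to `L x` in `N` steps has a cost of at most a constant times the norm
of `x`. -/
theorem StepMap.exists_gauge_iterate_le (hC : IsProperCSet C) {N : ℕ}
    {L : EuclideanSpace ℝ (Fin n) →ₗ[ℝ] EuclideanSpace ℝ (Fin n)} (h : StepMap A B N L) :
    ∃ M : ℝ, 0 ≤ M ∧ ∀ P ∈ polarCSetStates n, ∀ x,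
      gauge (polarSet (polarSet ((setDynamics A B C)^[N] P))) x ≤
        M * ‖x‖ + gauge (polarSet (polarSet P)) (L x) := by
  induction h with
  | zero => exact ⟨0, le_rfl, fun P _ x => by simp⟩
  | @succ N L K _ ih =>
    obtain ⟨M, hM, hMx⟩ := ih
    obtain ⟨k₁, hk₁, h₁⟩ := exists_gauge_le hC.mem_nhds
    obtain ⟨k₂, hk₂, h₂⟩ := exists_norm_linearMap_le L
    obtain ⟨k₃, hk₃, h₃⟩ := exists_norm_linearMap_le K
    refine ⟨M + k₁ * (k₂ + k₃), by positivity, fun P hP x => ?_⟩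
    -- The last control step corresponds to the innermost application of the dynamics; `M` is
    -- uniform in the state, so the induction hypothesis applies to the image of `P`.
    rw [Function.iterate_succ_apply]
    have hF := isProperCSet_setDynamics A B hC hP
    have ha := hMx _ hF.mem_polarCSetStates x
    have hb : gauge (setDynamics A B C P) (L x) ≤
        bellmanObjective A B C (gauge (polarSet (polarSet P))) (L x) (K x) :=
      (gauge_setDynamics_le_iff hC hP).2 ⟨K x, le_rfl⟩
    rw [hF.polarSet_polarSet] at ha
    have hc : gauge C (jointVec (L x) (K x)) ≤ k₁ * (k₂ * ‖x‖ + k₃ * ‖x‖) :=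
      (h₁ _).trans (by
        gcongr
        exact (norm_jointVec_le _ _).trans (add_le_add (h₂ x) (h₃ x)))
    unfold bellmanObjective at hb
    simp only [LinearMap.add_apply, LinearMap.comp_apply]
    linarith

theorem antitone_iterate_setDynamics_univ (A : Matrix (Fin n) (Fin n) ℝ)
    (B : Matrix (Fin n) (Fin m) ℝ) (C : Set (EuclideanSpace ℝ (Fin n ⊕ Fin m))) :
    Antitone fun k => (setDynamics A B C)^[k] Set.univ :=
  (setDynamics_mono A B C).antitone_iterate_of_map_le (Set.subset_univ _)

/-- Under strict stabilizability, the iterates started at the whole space contain a common ball. -/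
theorem IsStrictlyStabilizable.exists_ball_subset (hAB : IsStrictlyStabilizable A B)
    (hC : IsProperCSet C) :
    ∃ r : ℝ, 0 < r ∧ ∀ k x, ‖x‖ ≤ r → x ∈ (setDynamics A B C)^[k] Set.univ := by
  obtain ⟨N, L, hN, hstep, hL⟩ := hAB.exists_stepMap
  obtain ⟨M, hM, hMx⟩ := hstep.exists_gauge_iterate_le hC
  -- `2 * M` is the sum of the geometric series of costs: `M + 2 * M / 2 = 2 * M`.
  have hbound : ∀ j x, gauge (polarSet (polarSet ((setDynamics A B C)^[N * j] Set.univ))) x ≤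
      2 * M * ‖x‖ := by
    intro j
    induction j with
    | zero =>
      intro x
      refine univ_mem_polarCSetStates.2.gauge_polarSet_le_iff.2 fun w hw => ?_
      rw [polarSet_univ, Set.mem_singleton_iff] at hw
      subst hw
      rw [inner_zero_left]
      positivity
    | succ j ih =>
      intro x
      have h := hMx _ (iterate_setDynamics_mem_polarCSetStates (A := A) (B := B) hC
        univ_mem_polarCSetStates (N * j)) x
      rw [← Function.iterate_add_apply, show N + N * j = N * (j + 1) by ring] at h
      have := ih (L x)
      nlinarith [hL x]
  refine ⟨(2 * M + 1)⁻¹, by positivity, fun k x hx => ?_⟩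
  rcases k with _ | k
  · trivial
  -- The iterates decrease and `k + 1 ≤ N * (k + 1)`, so multiples of `N` suffice.
  refine antitone_iterate_setDynamics_univ A B C (Nat.le_mul_of_pos_left (k + 1) hN) ?_
  obtain ⟨l, hl⟩ : ∃ l, N * (k + 1) = l + 1 := Nat.exists_eq_add_one.2 (by positivity)
  have hproper := isProperCSet_iterate_setDynamics (A := A) (B := B) hC
    univ_mem_polarCSetStates l
  rw [← hl] at hproper
  rw [← hproper.gauge_le_one_iff]
  have h := hbound (k + 1) x
  rw [hproper.polarSet_polarSet] at h
  refine h.trans ?_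
  calc 2 * M * ‖x‖ ≤ (2 * M + 1) * (2 * M + 1)⁻¹ := by gcongr; linarith
    _ = 1 := mul_inv_cancel₀ (by positivity)

theorem continuous_bellmanObjective (hC : IsProperCSet C) (hP : IsProperCSet P)
    (x : EuclideanSpace ℝ (Fin n)) : Continuous (bellmanObjective A B C (gauge P) x) := by
  have h1 := continuous_gauge hC.1.2.1 hC.mem_nhds
  have h2 := continuous_gauge hP.1.2.1 hP.mem_nhds
  exact (h1.comp (continuous_jointVec x)).add
    (h2.comp (continuous_const.add (LinearMap.continuous_of_finiteDimensional _)))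

theorem IsStrictlyStabilizable.exists_fixedPoint (hAB : IsStrictlyStabilizable A B)
    (hC : IsProperCSet C) :
    ∃ P : Set (EuclideanSpace ℝ (Fin n)), IsProperCSet P ∧ P = setDynamics A B C P := by
  obtain ⟨r, hr, hball⟩ := hAB.exists_ball_subset hC
  -- The index is shifted because the whole space itself need not be compact.
  set I : ℕ → Set (EuclideanSpace ℝ (Fin n)) := fun k => (setDynamics A B C)^[k + 1] Set.univ
    with hI
  have hIp : ∀ k, IsProperCSet (I k) :=
    isProperCSet_iterate_setDynamics hC univ_mem_polarCSetStates
  have hanti : ∀ k, I (k + 1) ⊆ I k := fun k =>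
    antitone_iterate_setDynamics_univ A B C (Nat.le_succ _)
  have hsucc : ∀ k, I (k + 1) = setDynamics A B C (I k) := fun k =>
    Function.iterate_succ_apply' _ _ _
  have hP : IsProperCSet (⋂ k, I k) :=
    IsProperCSet.of_bounds
      ((hIp 0).1.1.of_isClosed_subset (isClosed_iInter fun k => (hIp k).1.1.isClosed)
        (Set.iInter_subset I 0))
      (convex_iInter fun k => (hIp k).1.2.1) hr
      fun x hx => Set.mem_iInter.2 fun k => hball (k + 1) x hx
  refine ⟨⋂ k, I k, hP, Set.Subset.antisymm (fun x hx => ?_) (Set.subset_iInter fun k => ?_)⟩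
  · obtain ⟨R, hR, hRC⟩ := hC.exists_norm_le
    have hclosed : ∀ k, IsClosed {u | bellmanObjective A B C (gauge (I k)) x u ≤ 1} := fun k =>
      isClosed_le (continuous_bellmanObjective hC (hIp k) x) continuous_const
    -- Cantor's intersection theorem: the controls of cost at most one form a decreasing sequence of
    -- nonempty compact sets, so one control serves all iterates.
    have hne : (⋂ k, {u | bellmanObjective A B C (gauge (I k)) x u ≤ 1}).Nonempty := by
      refine IsCompact.nonempty_iInter_of_sequence_nonempty_isCompact_isClosed _
        (fun k u hu => ?_) (fun k => ?_) ?_ hclosed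
      · exact (add_le_add le_rfl (gauge_mono (hIp (k + 1)).absorbent (hanti k) _)).trans hu
      · have hxk := Set.mem_iInter.1 hx (k + 1)
        rw [hsucc, mem_setDynamics_iff hC (hIp k).mem_polarCSetStates,
          (hIp k).polarSet_polarSet] at hxk
        exact hxk
      · refine (isCompact_closedBall (0 : EuclideanSpace ℝ (Fin m)) R).of_isClosed_subset
          (hclosed 0) fun u hu => mem_closedBall_zero_iff.2 ?_
        have hu : gauge C (jointVec x u) + gauge (I 0) _ ≤ 1 := hu
        calc ‖u‖ ≤ ‖jointVec x u‖ := norm_snd_le_norm_jointVec x u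
          _ ≤ R * gauge C (jointVec x u) := hRC _
          _ ≤ R * 1 := by
            gcongr
            linarith [gauge_nonneg (s := I 0)
              (Matrix.toEuclideanLin A x + Matrix.toEuclideanLin B u)]
          _ = R := mul_one R
    obtain ⟨u, hu⟩ := hne
    rw [mem_setDynamics_iff hC hP.mem_polarCSetStates, hP.polarSet_polarSet]
    refine ⟨u, ?_⟩
    have hu : ∀ k, gauge C (jointVec x u) +
      gauge (I k) (Matrix.toEuclideanLin A x + Matrix.toEuclideanLin B u) ≤ 1 :=
      fun k => Set.mem_iInter.1 hu k
    have h0 : 0 ≤ 1 - gauge C (jointVec x u) := by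
      linarith [hu 0, gauge_nonneg (s := I 0)
        (Matrix.toEuclideanLin A x + Matrix.toEuclideanLin B u)]
    have : gauge (⋂ k, I k) (Matrix.toEuclideanLin A x + Matrix.toEuclideanLin B u) ≤
        1 - gauge C (jointVec x u) := by
      refine le_of_forall_pos_imp_le h0 fun s hs hts => (hP.gauge_le_iff hs).2 ?_
      exact Set.mem_iInter.2 fun k => ((hIp k).gauge_le_iff hs).1 (by linarith [hu k])
    unfold bellmanObjective
    linarith
  · exact (setDynamics_mono A B C (Set.iInter_subset I k)).trans ((hsucc k).ge.trans (hanti k))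

end FixedPoint

/-! ### Contraction of relative errors, attraction, stability and uniqueness. -/

section Attractor

variable {n m : ℕ} {A : Matrix (Fin n) (Fin n) ℝ} {B : Matrix (Fin n) (Fin m) ℝ}
  {C : Set (EuclideanSpace ℝ (Fin n ⊕ Fin m))} {P Q : Set (EuclideanSpace ℝ (Fin n))}

/-- The Minkowski function of the bipolar of `P` is, up to the relative errors `a` and `b`, that
of `Q`. -/
def GaugeSandwich (Q : Set (EuclideanSpace ℝ (Fin n))) (a b : ℝ)
    (P : Set (EuclideanSpace ℝ (Fin n))) : Prop :=
  ∀ x, (1 - a) * gauge Q x ≤ gauge (polarSet (polarSet P)) x ∧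
    gauge (polarSet (polarSet P)) x ≤ (1 + b) * gauge Q x

/-- The set dynamics contracts the relative distance to a fixed point. -/
theorem exists_contraction (hC : IsProperCSet C) (hQ : IsProperCSet Q)
    (hfix : Q = setDynamics A B C Q) :
    ∃ β : ℝ, 0 ≤ β ∧ β < 1 ∧ ∀ P ∈ polarCSetStates n, ∀ a b : ℝ, 0 ≤ a → a ≤ 1 → 0 ≤ b →
      GaugeSandwich Q a b P → GaugeSandwich Q (β * a) (β * b) (setDynamics A B C P) := by
  obtain ⟨R, hR, hRC⟩ := hC.exists_norm_le
  obtain ⟨K, hK, hKQ⟩ := exists_gauge_le hQ.mem_nhds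
  obtain ⟨k₁, hk₁, h₁⟩ := exists_norm_linearMap_le (Matrix.toEuclideanLin A)
  obtain ⟨k₂, hk₂, h₂⟩ := exists_norm_linearMap_le (Matrix.toEuclideanLin B)
  set D := K * ((k₁ + k₂) * R) with hD
  have hDpos : 0 < D := by positivity
  have hDb : ∀ x u, gauge Q (Matrix.toEuclideanLin A x + Matrix.toEuclideanLin B u) ≤
      D * gauge C (jointVec x u) := fun x u => by
    calc gauge Q (Matrix.toEuclideanLin A x + Matrix.toEuclideanLin B u)
        ≤ K * ‖Matrix.toEuclideanLin A x + Matrix.toEuclideanLin B u‖ := hKQ _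
      _ ≤ K * (k₁ * ‖x‖ + k₂ * ‖u‖) := by
        gcongr
        exact (norm_add_le _ _).trans (add_le_add (h₁ x) (h₂ u))
      _ ≤ K * (k₁ * (R * gauge C (jointVec x u)) + k₂ * (R * gauge C (jointVec x u))) := by
        gcongr
        · exact (norm_fst_le_norm_jointVec x u).trans (hRC _)
        · exact (norm_snd_le_norm_jointVec x u).trans (hRC _)
      _ = D * gauge C (jointVec x u) := by rw [hD]; ring
  -- A cost-to-go of at most `D` times the stage cost is at most `D / (1 + D)` of their sum.
  set β := D / (1 + D) with hβ
  have hβ0 : 0 ≤ β := by positivity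
  have hβ1 : β < 1 := by rw [hβ, div_lt_one (by positivity)]; linarith
  have hβb : ∀ x u, gauge Q (Matrix.toEuclideanLin A x + Matrix.toEuclideanLin B u) ≤
      β * (gauge C (jointVec x u) +
        gauge Q (Matrix.toEuclideanLin A x + Matrix.toEuclideanLin B u)) := fun x u => by
    rw [hβ, div_mul_eq_mul_div, le_div_iff₀ (by positivity)]
    linarith [hDb x u]
  have hQle : ∀ {t : ℝ} {x}, gauge Q x ≤ t ↔ ∃ u, bellmanObjective A B C (gauge Q) x u ≤ t := by
    intro t x
    have := gauge_setDynamics_le_iff (A := A) (B := B) hC hQ.mem_polarCSetStates (t := t) (x := x)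
    rwa [← hfix, hQ.polarSet_polarSet] at this
  refine ⟨β, hβ0, hβ1, fun P hP a b ha ha1 hb h x => ?_⟩
  rw [(isProperCSet_setDynamics A B hC hP).polarSet_polarSet]
  constructor
  -- The lower bound tests `Q` with an optimal control for `P`; the upper bound tests `P` with one
  -- for `Q`.
  · obtain ⟨u, hu⟩ := (gauge_setDynamics_le_iff hC hP).1
      (le_refl (gauge (setDynamics A B C P) x))
    refine le_trans ?_ hu
    have hV : gauge Q x ≤ bellmanObjective A B C (gauge Q) x u := hQle.2 ⟨u, le_rfl⟩
    unfold bellmanObjective at hV ⊢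
    have h1 := (h (Matrix.toEuclideanLin A x + Matrix.toEuclideanLin B u)).1
    have h2 := mul_le_mul_of_nonneg_left (hβb x u) ha
    have h3 := mul_le_mul_of_nonneg_left hV (show 0 ≤ 1 - β * a by nlinarith)
    linarith
  · obtain ⟨u, hu⟩ := hQle.1 (le_refl (gauge Q x))
    refine (gauge_setDynamics_le_iff hC hP).2 ⟨u, ?_⟩
    unfold bellmanObjective at hu ⊢
    have h1 := (h (Matrix.toEuclideanLin A x + Matrix.toEuclideanLin B u)).2
    have h2 := mul_le_mul_of_nonneg_left (hβb x u) hb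
    have h3 := mul_le_mul_of_nonneg_left hu (show 0 ≤ 1 + β * b by positivity)
    linarith

/-- With `a = 1` the lower bound is mere nonnegativity, so even unbounded states have a finite
relative error to be contracted. -/
theorem exists_gaugeSandwich (hQ : IsProperCSet Q) (hP : P ∈ polarCSetStates n) :
    ∃ b : ℝ, 0 ≤ b ∧ GaugeSandwich Q 1 b P := by
  obtain ⟨R, hR, hRQ⟩ := hQ.exists_norm_le
  obtain ⟨K, hK, hKP⟩ := exists_gauge_le hP.2.polarSet_mem_nhds
  refine ⟨K * R, by positivity, fun x => ⟨by simpa using gauge_nonneg _, ?_⟩⟩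
  have := mul_le_mul_of_nonneg_left (hRQ x) hK.le
  linarith [hKP x, gauge_nonneg (s := Q) x]

/-- A sandwich between dilations of `Q` bounds the Hausdorff distance to `Q`. -/
theorem exists_hausdorffEDist_le (hQ : IsProperCSet Q) :
    ∃ R : ℝ, 0 < R ∧ ∀ P, IsProperCSet P → ∀ a b : ℝ, 0 ≤ a → a ≤ 1 / 2 → 0 ≤ b →
      GaugeSandwich Q a b P →
        Metric.hausdorffEDist P Q ≤ ENNReal.ofReal (R * (a + b)) := by
  obtain ⟨R, hR, hRQ⟩ := hQ.exists_norm_le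
  refine ⟨2 * R, by positivity, fun P hP a b ha ha2 hb h => ?_⟩
  unfold GaugeSandwich at h
  rw [hP.polarSet_polarSet] at h
  refine Metric.hausdorffEDist_le_of_mem_edist (fun x hx => ?_) (fun x hx => ?_)
  -- Nearby points are chosen on the same ray. The bound `a ≤ 1 / 2` gives `gauge Q x ≤ 2`, whence
  -- the factor in `2 * R`.
  · have h1 : (1 - a) * gauge Q x ≤ 1 := (h x).1.trans (hP.gauge_le_one_iff.2 hx)
    refine ⟨(1 - a) • x, ?_, ?_⟩
    · rwa [← hQ.gauge_le_one_iff, gauge_smul_of_nonneg (show 0 ≤ 1 - a by linarith), smul_eq_mul]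
    · rw [edist_dist, dist_eq_norm, show x - (1 - a) • x = a • x by module, norm_smul,
        Real.norm_of_nonneg ha]
      refine ENNReal.ofReal_le_ofReal ?_
      have h2 : gauge Q x ≤ 2 := by nlinarith [gauge_nonneg (s := Q) x]
      have h3 : ‖x‖ ≤ R * 2 := (hRQ x).trans (by gcongr)
      nlinarith
  · have h1 : gauge Q x ≤ 1 := hQ.gauge_le_one_iff.2 hx
    have hb1 : 0 < 1 + b := by linarith
    refine ⟨(1 + b)⁻¹ • x, ?_, ?_⟩
    · rw [← hP.gauge_le_iff hb1]
      nlinarith [(h x).2]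
    · have : x - (1 + b)⁻¹ • x = (b * (1 + b)⁻¹) • x := by
        rw [show b * (1 + b)⁻¹ = 1 - (1 + b)⁻¹ by field_simp; ring]
        module
      rw [edist_dist, dist_eq_norm, this, norm_smul, Real.norm_of_nonneg (by positivity)]
      refine ENNReal.ofReal_le_ofReal ?_
      have h3 : ‖x‖ ≤ R * 1 := (hRQ x).trans (by gcongr)
      have h4 : (1 + b)⁻¹ ≤ 1 := inv_le_one_of_one_le₀ (by linarith)
      calc b * (1 + b)⁻¹ * ‖x‖ ≤ b * 1 * (R * 1) := by gcongr
        _ ≤ 2 * R * (a + b) := by nlinarith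

/-- A state close to `Q` in the Hausdorff distance is sandwiched between dilations of `Q`. -/
theorem exists_gaugeSandwich_of_hausdorffEDist_lt (hQ : IsProperCSet Q) {s : ℝ} (hs : 0 < s)
    (hs2 : s ≤ 1 / 2) :
    ∃ δ : ℝ≥0∞, 0 < δ ∧ ∀ P ∈ polarCSetStates n, Metric.hausdorffEDist P Q < δ →
      GaugeSandwich Q s (2 * s) P := by
  obtain ⟨K, hK, hKQ⟩ := exists_gauge_le hQ.mem_nhds
  refine ⟨ENNReal.ofReal (s / K), ENNReal.ofReal_pos.2 (by positivity), fun P hP hd x => ?_⟩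
  have hsmall : ∀ y z, edist y z < ENNReal.ofReal (s / K) → gauge Q (y - z) ≤ s := by
    intro y z hyz
    rw [edist_dist, ENNReal.ofReal_lt_ofReal_iff (by positivity), dist_eq_norm,
      lt_div_iff₀ hK] at hyz
    linarith [hKQ (y - z)]
  have hQi : ∀ {w z}, w ∈ polarSet Q → inner ℝ w z ≤ gauge Q z := by
    intro w z hw
    have := hQ.isCSet_polarSet.inner_le_gauge_polarSet hw (x := z)
    rwa [hQ.polarSet_polarSet] at this
  constructor
  · have h1 : gauge Q x ≤ (1 + s) * gauge (polarSet (polarSet P)) x := by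
      rw [← hQ.polarSet_polarSet, hQ.isCSet_polarSet.gauge_polarSet_le_iff]
      intro w hw
      -- Each `y ∈ P` is near some `z ∈ Q`, so `w ∈ Q*` takes at most the value `1 + s` on `P`.
      have hmem : (1 + s)⁻¹ • w ∈ polarSet P := by
        intro y hy
        obtain ⟨z, hz, hyz⟩ := Metric.exists_edist_lt_of_hausdorffEDist_lt hy hd
        rw [inner_smul_right, inv_mul_le_iff₀ (by positivity), mul_one, real_inner_comm]
        have h2 := gauge_add_le hQ.1.2.1 hQ.absorbent z (y - z)
        rw [add_sub_cancel] at h2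
        linarith [hsmall y z hyz, hQ.gauge_le_one_iff.2 hz, hQi hw (z := y)]
      have := hP.2.inner_le_gauge_polarSet hmem (x := x)
      rwa [real_inner_smul_left, inv_mul_le_iff₀ (by positivity)] at this
    have h2 := gauge_nonneg (s := Q) x
    have h3 := mul_le_mul_of_nonneg_left h1 (show 0 ≤ 1 - s by linarith)
    have h4 := gauge_nonneg (s := polarSet (polarSet P)) x
    nlinarith [mul_nonneg (sq_nonneg s) h4]
  · rw [hP.2.gauge_polarSet_le_iff]
    intro w hw
    -- A point of `P` near the maximiser `z` of `w` on `Q` gives `(1 - s) * ⟪w, z⟫ ≤ 1`, hence `(1 -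
    -- s) • w ∈ Q*`. The error `2 * s` comes from `1 / (1 - s) ≤ 1 + 2 * s` for `s ≤ 1 / 2`.
    obtain ⟨z, hz, hmax⟩ := hQ.1.1.exists_isMaxOn ⟨0, hQ.1.2.2⟩
      (f := fun y => inner ℝ w y) (by fun_prop)
    have hmax : ∀ y ∈ Q, inner ℝ w y ≤ inner ℝ w z := fun y hy => hmax hy
    rw [Metric.hausdorffEDist_comm] at hd
    obtain ⟨y, hy, hzy⟩ := Metric.exists_edist_lt_of_hausdorffEDist_lt hz hd
    have h1 : inner ℝ w (z - y) ≤ s * inner ℝ w z := by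
      have := hmax _ ((hQ.gauge_le_iff hs).1 (hsmall z y hzy))
      rwa [inner_smul_right, inv_mul_le_iff₀ hs] at this
    have h2 : inner ℝ w y ≤ 1 := by
      rw [real_inner_comm]
      exact hw y hy
    rw [inner_sub_right] at h1
    have hmem : (1 - s) • w ∈ polarSet Q := by
      intro v hv
      rw [inner_smul_right, real_inner_comm]
      have := mul_le_mul_of_nonneg_left (hmax v hv) (show 0 ≤ 1 - s by linarith)
      linarith
    have h3 := hQi hmem (z := x)
    rw [real_inner_smul_left] at h3
    have h4 := gauge_nonneg (s := Q) x
    have h5 := mul_le_mul_of_nonneg_left h3 (show 0 ≤ 1 + 2 * s by linarith)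
    have h6 : 0 ≤ s * (1 - 2 * s) := mul_nonneg hs.le (by linarith)
    by_cases h7 : 0 ≤ inner ℝ w x
    · nlinarith [mul_nonneg h6 h7]
    · nlinarith

theorem gaugeSandwich_iterate (hC : IsProperCSet C) {β : ℝ} (hβ0 : 0 ≤ β) (hβ1 : β < 1)
    (hβ : ∀ P ∈ polarCSetStates n, ∀ a b : ℝ, 0 ≤ a → a ≤ 1 → 0 ≤ b →
      GaugeSandwich Q a b P → GaugeSandwich Q (β * a) (β * b) (setDynamics A B C P))
    (hP : P ∈ polarCSetStates n) {a b : ℝ} (ha : 0 ≤ a) (ha1 : a ≤ 1) (hb : 0 ≤ b)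
    (h : GaugeSandwich Q a b P) (k : ℕ) :
    GaugeSandwich Q (β ^ k * a) (β ^ k * b) ((setDynamics A B C)^[k] P) := by
  induction k with
  | zero => simpa using h
  | succ k ih =>
    rw [Function.iterate_succ_apply', pow_succ', mul_assoc, mul_assoc]
    exact hβ _ (iterate_setDynamics_mem_polarCSetStates hC hP k) _ _ (by positivity)
      (mul_le_one₀ (pow_le_one₀ hβ0 hβ1.le) ha ha1) (by positivity) ih

theorem tendsto_hausdorffEDist_iterate (hC : IsProperCSet C) (hQ : IsProperCSet Q)
    (hfix : Q = setDynamics A B C Q) (hP : P ∈ polarCSetStates n) :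
    Tendsto (fun k : ℕ => Metric.hausdorffEDist ((setDynamics A B C)^[k] P) Q) atTop (𝓝 0) := by
  obtain ⟨β, hβ0, hβ1, hβ⟩ := exists_contraction hC hQ hfix
  obtain ⟨b, hb, hsand⟩ := exists_gaugeSandwich hQ hP
  obtain ⟨R, hR, hdist⟩ := exists_hausdorffEDist_le hQ
  have hpow := tendsto_pow_atTop_nhds_zero_of_lt_one hβ0 hβ1
  have hlim : Tendsto (fun k : ℕ => ENNReal.ofReal (R * (β ^ k * 1 + β ^ k * b))) atTop (𝓝 0) := by
    have := ((hpow.mul_const 1).add (hpow.mul_const b)).const_mul R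
    simpa using ENNReal.tendsto_ofReal this
  refine tendsto_of_tendsto_of_tendsto_of_le_of_le' tendsto_const_nhds hlim
    (Eventually.of_forall fun _ => zero_le) ?_
  -- The distance bound needs a lower error of at most `1 / 2` and a proper `C`-set, which the
  -- initial state need not be.
  filter_upwards [hpow.eventually_lt_const (show (0 : ℝ) < 1 / 2 by norm_num),
    eventually_ge_atTop 1] with k hk hk1
  obtain ⟨l, rfl⟩ := Nat.exists_eq_add_of_le' hk1
  exact hdist _ (isProperCSet_iterate_setDynamics hC hP l) _ _ (by positivity) (by linarith)
    (by positivity) (gaugeSandwich_iterate hC hβ0 hβ1 hβ hP zero_le_one le_rfl hb hsand (l + 1))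

theorem lyapunov_stable_of_fixedPoint (hC : IsProperCSet C) (hQ : IsProperCSet Q)
    (hfix : Q = setDynamics A B C Q) {ε : ℝ≥0∞} (hε : 0 < ε) :
    ∃ δ : ℝ≥0∞, 0 < δ ∧ ∀ P ∈ polarCSetStates n, Metric.hausdorffEDist P Q < δ →
      ∀ k : ℕ, Metric.hausdorffEDist ((setDynamics A B C)^[k] P) Q < ε := by
  obtain ⟨β, hβ0, hβ1, hβ⟩ := exists_contraction hC hQ hfix
  obtain ⟨R, hR, hdist⟩ := exists_hausdorffEDist_le hQ
  obtain ⟨e, he, heε⟩ : ∃ e : ℝ, 0 < e ∧ ENNReal.ofReal e ≤ ε := by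
    obtain ⟨e, he, heε⟩ := ENNReal.lt_iff_exists_nnreal_btwn.1 hε
    exact ⟨e, by exact_mod_cast he, by simpa using heε.le⟩
  set s := min (1 / 2) (e / (4 * R)) with hs
  have hs0 : 0 < s := by positivity
  have hs2 : s ≤ 1 / 2 := min_le_left _ _
  have hsR : R * (s + 2 * s) < e := by
    have : s ≤ e / (4 * R) := min_le_right _ _
    rw [le_div_iff₀ (by positivity)] at this
    nlinarith
  obtain ⟨δ, hδ, hsand⟩ := exists_gaugeSandwich_of_hausdorffEDist_lt hQ hs0 hs2
  -- The minimum with `ε` handles time zero, where the state may not be a proper `C`-set.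
  refine ⟨min δ ε, lt_min hδ hε, fun P hP hd k => ?_⟩
  rcases k with _ | k
  · exact hd.trans_le (min_le_right _ _)
  have hpow : β ^ (k + 1) ≤ 1 := pow_le_one₀ hβ0 hβ1.le
  refine (hdist _ (isProperCSet_iterate_setDynamics hC hP k) _ _ (by positivity) ?_ (by positivity)
    (gaugeSandwich_iterate hC hβ0 hβ1 hβ hP hs0.le (by linarith) (by positivity)
      (hsand P hP (hd.trans_le (min_le_left _ _))) (k + 1))).trans_lt
    (lt_of_lt_of_le ?_ heε)
  · nlinarith
  · rw [ENNReal.ofReal_lt_ofReal_iff he]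
    refine lt_of_le_of_lt ?_ hsR
    exact mul_le_mul_of_nonneg_left (add_le_add (mul_le_of_le_one_left hs0.le hpow)
      (mul_le_of_le_one_left (by positivity) hpow)) hR.le

/-- The trajectory of a second fixed point is constant yet converges to `Q`; closed sets at
Hausdorff distance zero coincide. -/
theorem fixedPoint_unique (hC : IsProperCSet C) (hQ : IsProperCSet Q)
    (hfix : Q = setDynamics A B C Q) (hP : IsProperCSet P) (hPfix : P = setDynamics A B C P) :
    P = Q := by
  have h := tendsto_hausdorffEDist_iterate hC hQ hfix hP.mem_polarCSetStates
  simp_rw [Function.iterate_fixed hPfix.symm] at h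
  exact (hP.1.1.isClosed.hausdorffEDist_zero_iff hQ.1.1.isClosed).1
    (tendsto_nhds_unique tendsto_const_nhds h)

/-- For a proper `C`-set, the Minkowski–Bellman equation is the fixed point set equation. -/
theorem fixedPoint_iff_isLeast (hC : IsProperCSet C) (hP : IsProperCSet P) :
    P = setDynamics A B C P ↔
      ∀ x, IsLeast (Set.range (bellmanObjective A B C (gauge P) x)) (gauge P x) := by
  have hF : ∀ x, IsLeast (Set.range (bellmanObjective A B C (gauge P) x))
      (gauge (setDynamics A B C P) x) := by
    intro x
    have key : ∀ {t : ℝ}, gauge (setDynamics A B C P) x ≤ t ↔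
        ∃ u, bellmanObjective A B C (gauge P) x u ≤ t := by
      intro t
      rw [gauge_setDynamics_le_iff hC hP.mem_polarCSetStates, hP.polarSet_polarSet]
    obtain ⟨u, hu⟩ := key.1 le_rfl
    refine ⟨⟨u, hu.antisymm (key.2 ⟨u, le_rfl⟩)⟩, ?_⟩
    rintro _ ⟨v, rfl⟩
    exact key.2 ⟨v, le_rfl⟩
  constructor
  · intro h x
    have := hF x
    rwa [← h] at this
  · intro h
    exact hP.gauge_injective (isProperCSet_setDynamics A B hC hP.mem_polarCSetStates)
      (funext fun x => (h x).unique (hF x))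

end Attractor

/-! ### The main theorem. -/

theorem theorem5p3 {n m : ℕ} (A : Matrix (Fin n) (Fin n) ℝ) (B : Matrix (Fin n) (Fin m) ℝ)
    (C : Set (EuclideanSpace ℝ (Fin n ⊕ Fin m)))
    (hAB : IsStrictlyStabilizable A B) (hC : IsProperCSet C) :
    ∃ P : Set (EuclideanSpace ℝ (Fin n)),
      -- `P` is the unique proper `C`-set solving the fixed point set equation
      (IsProperCSet P ∧ P = setDynamics A B C P) ∧
      (∀ Q : Set (EuclideanSpace ℝ (Fin n)), IsProperCSet Q → Q = setDynamics A B C Q → Q = P) ∧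
      -- the set dynamics is well posed and `P` is an asymptotically stable attractor for it
      (∀ P₀ ∈ polarCSetStates n, IsProperCSet (setDynamics A B C P₀)) ∧
      P ∈ polarCSetStates n ∧
      IsAsymptoticallyStableAttractor (setDynamics A B C) (polarCSetStates n) P ∧
      -- every state is attracted; in terms of polars, these are exactly the `C`-sets
      domainOfAttraction (setDynamics A B C) (polarCSetStates n) P = polarCSetStates n ∧
      polarSet '' domainOfAttraction (setDynamics A B C) (polarCSetStates n) P =
        {Q : Set (EuclideanSpace ℝ (Fin n)) | IsCSet Q} ∧
      -- the Minkowski function of `P` is the unique fixed point value function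
      (∃ U, IsMinkowskiBellmanFixedPoint A B C (gauge P) U) ∧
      (∀ V U, (∃ Q : Set (EuclideanSpace ℝ (Fin n)), IsProperCSet Q ∧ V = gauge Q) →
        IsMinkowskiBellmanFixedPoint A B C V U → V = gauge P) := by
  obtain ⟨P, hP, hfix⟩ := hAB.exists_fixedPoint hC
  have hdom : domainOfAttraction (setDynamics A B C) (polarCSetStates n) P =
      polarCSetStates n :=
    Set.Subset.antisymm (fun _ h => h.1)
      fun _ h => ⟨h, tendsto_hausdorffEDist_iterate hC hP hfix h⟩
  refine ⟨P, ⟨hP, hfix⟩, fun Q hQ hQfix => fixedPoint_unique hC hP hfix hQ hQfix,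
    fun P₀ h => isProperCSet_setDynamics A B hC h, hP.mem_polarCSetStates,
    ⟨fun ε hε => lyapunov_stable_of_fixedPoint hC hP hfix hε,
      1, one_pos, fun P₀ h _ => hdom.symm ▸ h⟩, hdom, ?_, ?_, ?_⟩
  · rw [hdom]
    refine Set.Subset.antisymm (Set.image_subset_iff.2 fun Q hQ => hQ.2) fun Q hQ => ?_
    have hQ : IsCSet Q := hQ
    -- Every `C`-set is the polar of its own polar, which may be unbounded; the state space admits
    -- such sets.
    exact ⟨polarSet Q, ⟨zero_mem_polarSet Q, by rwa [hQ.polarSet_polarSet]⟩,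
      hQ.polarSet_polarSet⟩
  · exact ⟨fun x => {u | ∀ v, bellmanObjective A B C (gauge P) x u ≤
      bellmanObjective A B C (gauge P) x v},
      fun x => ⟨(fixedPoint_iff_isLeast hC hP).1 hfix x, rfl⟩⟩
  · rintro _ U ⟨Q, hQ, rfl⟩ hU
    rw [fixedPoint_unique hC hP hfix hQ ((fixedPoint_iff_isLeast hC hQ).2 fun x => (hU x).1)]
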